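/- Let $N\ge 1$ be an integer, let $U(N)$ be the group of $N\times N$ complex unitary matrices with identity $I$, and let $\sigma$ be the Haar probability measure on $U(N)$. For a complex $N\times N$ matrix $M=(m_{ij})$ let $\|M\|=\bigl(\sum_{i,j=1}^N |m_{ij}|^2\bigr)^{1/2}$ be its Hilbert–Schmidt norm. Then \[ \lim_{\delta\downarrow 0}\frac{\sigma(\{U\in U(N):\|I-U\|\le\delta\})}{\delta^{N^2}} =\frac{\prod_{j=1}^{N-1} j!}{(2\pi)^{N/2}\,2^{N^2/2}\,\Gamma(N^2/2+1)}\,, \] where the empty product (for $N=1$) equals $1$. -/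

import Mathlib

open MeasureTheory Filter Topology

open scoped Nat

/-- The Hilbert–Schmidt norm `(∑ᵢⱼ |mᵢⱼ|²)^{1/2}` of a complex square matrix. -/
noncomputable def hsNorm {N : ℕ} (M : Matrix (Fin N) (Fin N) ℂ) : ℝ :=
  √(∑ i, ∑ j, ‖M i j‖ ^ 2)

/-- `hsNorm` is Mathlib's Frobenius norm. -/
theorem hsNorm_eq_frobenius {N : ℕ} (M : Matrix (Fin N) (Fin N) ℂ) :
    hsNorm M = Matrix.frobeniusNormedAddCommGroup.toNorm.norm M := by
  rw [hsNorm, Matrix.frobenius_norm_def, Real.sqrt_eq_rpow]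
  norm_cast

/-
A Tauberian argument of Karamata type turns the small-ball asymptotics at the identity into the
asymptotics of high moments of a function with a nondegenerate maximum there, and we take
`|det ((1 + U) / 2)|²`: it lies between `1 - ‖1 - U‖² / 4` and `exp (-‖1 - U‖² / 4)`, and its
moments are explicit. Indeed `det (1 + U)` is `1 + u₀₀` times `det (1 + ρ U)`, where `ρ U` is the
unitary matrix one size smaller obtained from `U` by taking a Schur complement. Since `ρ` commutes
with multiplication by the smaller unitary group, `ρ U` is Haar distributed and independent of
`u₀₀`, so that the moments factor over the dimensions. Each factor is a moment of `|1 + u₀₀|`,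
which the invariance of the Haar measure determines, and the Wallis product gives the limit.
-/

section Moments

theorem integrable_of_ae_mem_Icc {a b : ℝ} {ν : Measure ℝ} [IsFiniteMeasure ν]
    (hν : ∀ᵐ x ∂ν, x ∈ Set.Icc a b) {h : ℝ → ℝ} (hh : Continuous h) : Integrable h ν := by
  obtain ⟨M, hM⟩ := isCompact_Icc.exists_bound_of_continuousOn hh.continuousOn
  exact .of_bound hh.aestronglyMeasurable M (hν.mono hM)

variable {ι : Type*} {l : Filter ι} {a b : ℝ} {ν : ι → Measure ℝ} {ν₀ : Measure ℝ}
  [∀ i, IsFiniteMeasure (ν i)] [IsFiniteMeasure ν₀]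

theorem tendsto_integral_polynomial_of_tendsto_moments (hν : ∀ i, ∀ᵐ x ∂ν i, x ∈ Set.Icc a b)
    (hν₀ : ∀ᵐ x ∂ν₀, x ∈ Set.Icc a b)
    (hmom : ∀ m : ℕ, Tendsto (fun i => ∫ x, x ^ m ∂ν i) l (𝓝 (∫ x, x ^ m ∂ν₀)))
    (p : Polynomial ℝ) :
    Tendsto (fun i => ∫ x, p.eval x ∂ν i) l (𝓝 (∫ x, p.eval x ∂ν₀)) := by
  induction p using Polynomial.induction_on' with
  | monomial m c =>
    simpa only [Polynomial.eval_monomial, integral_const_mul] using (hmom m).const_mul c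
  | add p q hp hq =>
    simp only [Polynomial.eval_add]
    rw [integral_add (integrable_of_ae_mem_Icc hν₀ p.continuous)
      (integrable_of_ae_mem_Icc hν₀ q.continuous)]
    refine (hp.add hq).congr fun i => ?_
    rw [integral_add (integrable_of_ae_mem_Icc (hν i) p.continuous)
      (integrable_of_ae_mem_Icc (hν i) q.continuous)]

theorem tendsto_integral_continuous_of_tendsto_moments (hν : ∀ i, ∀ᵐ x ∂ν i, x ∈ Set.Icc a b)
    (hν₀ : ∀ᵐ x ∂ν₀, x ∈ Set.Icc a b)
    (hmom : ∀ m : ℕ, Tendsto (fun i => ∫ x, x ^ m ∂ν i) l (𝓝 (∫ x, x ^ m ∂ν₀)))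
    {h : ℝ → ℝ} (hh : Continuous h) :
    Tendsto (fun i => ∫ x, h x ∂ν i) l (𝓝 (∫ x, h x ∂ν₀)) := by
  set M := ν₀.real Set.univ
  have hM : 0 ≤ M := measureReal_nonneg
  have hmass : Tendsto (fun i => (ν i).real Set.univ) l (𝓝 M) := by simpa using hmom 0
  refine Metric.tendsto_nhds.2 fun ε hε => ?_
  set δ := ε / (2 * M + 2)
  have hδ : 0 < δ := by positivity
  obtain ⟨p, hp⟩ := exists_polynomial_near_of_continuousOn a b h hh.continuousOn δ hδ
  have happrox {ρ : Measure ℝ} [IsFiniteMeasure ρ] (hρ : ∀ᵐ x ∂ρ, x ∈ Set.Icc a b) :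
      |∫ x, p.eval x ∂ρ - ∫ x, h x ∂ρ| ≤ δ * ρ.real Set.univ := by
    rw [← integral_sub (integrable_of_ae_mem_Icc hρ p.continuous) (integrable_of_ae_mem_Icc hρ hh)]
    exact norm_integral_le_of_norm_le_const (f := fun x => p.eval x - h x)
      (hρ.mono fun x hx => (hp x hx).le)
  filter_upwards [hmass.eventually_lt_const (lt_add_one M), Metric.tendsto_nhds.1
    (tendsto_integral_polynomial_of_tendsto_moments hν hν₀ hmom p) δ hδ] with i hi hpi
  rw [Real.dist_eq] at hpi ⊢
  calc |∫ x, h x ∂ν i - ∫ x, h x ∂ν₀|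
      ≤ |∫ x, p.eval x ∂ν i - ∫ x, h x ∂ν i| + |∫ x, p.eval x ∂ν i - ∫ x, p.eval x ∂ν₀| +
          |∫ x, p.eval x ∂ν₀ - ∫ x, h x ∂ν₀| := by
        rw [abs_sub_comm (∫ x, p.eval x ∂ν i)]
        exact (abs_sub_le _ _ _).trans (add_le_add_left (abs_sub_le _ _ _) _)
    _ < δ * (M + 1) + δ + δ * M :=
        add_lt_add_of_lt_of_le (add_lt_add_of_le_of_lt
          ((happrox (hν i)).trans (by gcongr)) hpi) (happrox hν₀)
    _ = ε := by simp only [δ]; field_simp; ring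

end Moments

section Portmanteau

variable {ι X : Type*} {l : Filter ι} [TopologicalSpace X] [MeasurableSpace X]
  [OpensMeasurableSpace X] [HasOuterApproxClosed X]

theorem tendsto_finiteMeasure_apply_of_null_frontier {ν : ι → FiniteMeasure X}
    {ν₀ : FiniteMeasure X} (hν : Tendsto ν l (𝓝 ν₀)) {E : Set X} (hE : ν₀ (frontier E) = 0) :
    Tendsto (fun i => ν i E) l (𝓝 (ν₀ E)) := by
  cases isEmpty_or_nonempty X
  · obtain rfl : E = Set.univ := Subsingleton.elim _ _
    exact hν.mass
  rcases eq_or_ne ν₀ 0 with rfl | h₀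
  · exact tendsto_of_tendsto_of_tendsto_of_le_of_le tendsto_const_nhds hν.mass
      (fun _ => zero_le) fun i => (ν i).apply_le_mass E
  · have hE' : ν₀.normalize (frontier E) = 0 := by
      rw [ν₀.normalize_eq_of_nonzero h₀, hE, mul_zero]
    rw [ν₀.self_eq_mass_mul_normalize]
    simp only [fun i => (ν i).self_eq_mass_mul_normalize E]
    exact hν.mass.mul (ProbabilityMeasure.tendsto_measure_of_null_frontier_of_tendsto
      (FiniteMeasure.tendsto_normalize_of_tendsto hν h₀) hE')

open scoped BoundedContinuousFunction in
theorem tendsto_setIntegral_of_null_frontier {ν : ι → Measure X} {ν₀ : Measure X}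
    [∀ i, IsFiniteMeasure (ν i)] [IsFiniteMeasure ν₀]
    (hν : ∀ h : X →ᵇ ℝ, Tendsto (fun i => ∫ x, h x ∂ν i) l (𝓝 (∫ x, h x ∂ν₀)))
    {g : X →ᵇ ℝ} (hg : ∀ x, 0 ≤ g x) {E : Set X} (hEm : MeasurableSet E)
    (hE : ν₀ (frontier E) = 0) :
    Tendsto (fun i => ∫ x in E, g x ∂ν i) l (𝓝 (∫ x in E, g x ∂ν₀)) := by
  have hgm : Measurable fun x => ENNReal.ofReal (g x) := by fun_prop
  have hfin (ρ : Measure X) [IsFiniteMeasure ρ] :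
      IsFiniteMeasure (ρ.withDensity fun x => ENNReal.ofReal (g x)) :=
    isFiniteMeasure_withDensity_ofReal (g.integrable ρ).2
  let θ (ρ : Measure X) [IsFiniteMeasure ρ] : FiniteMeasure X := ⟨_, hfin ρ⟩
  have hθ : Tendsto (fun i => θ (ν i)) l (𝓝 (θ ν₀)) := by
    refine FiniteMeasure.tendsto_iff_forall_integral_tendsto.2 fun h => ?_
    have hint (ρ : Measure X) [IsFiniteMeasure ρ] :
        ∫ x, h x ∂(θ ρ : Measure X) = ∫ x, (g * h) x ∂ρ := by
      refine (integral_withDensity_eq_integral_toReal_smul hgm (by simp) h).trans ?_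
      simp [ENNReal.toReal_ofReal, hg]
    simpa only [hint] using hν (g * h)
  have happ (ρ : Measure X) [IsFiniteMeasure ρ] : (θ ρ E : ℝ) = ∫ x in E, g x ∂ρ := by
    change ((θ ρ : Measure X) E).toReal = _
    rw [integral_eq_lintegral_of_nonneg_ae (.of_forall hg) g.continuous.aestronglyMeasurable]
    exact congrArg _ (withDensity_apply _ hEm)
  have hE' : θ ν₀ (frontier E) = 0 := by
    rw [FiniteMeasure.null_iff_toMeasure_null]
    exact withDensity_absolutelyContinuous _ _ hE
  simpa only [happ] using
    (NNReal.tendsto_coe.2 (tendsto_finiteMeasure_apply_of_null_frontier hθ hE'))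

end Portmanteau

section Gamma

open ProbabilityTheory

theorem gammaMeasure_Iio_zero (α r : ℝ) : gammaMeasure α r (Set.Iio 0) = 0 := by
  rw [gammaMeasure, withDensity_apply _ measurableSet_Iio, lintegral_gammaPDF_of_nonpos le_rfl]

theorem integral_gammaMeasure {α r : ℝ} (hα : 0 < α) (hr : 0 < r) (f : ℝ → ℝ) :
    ∫ t, f t ∂gammaMeasure α r =
      r ^ α / Real.Gamma α * ∫ t in Set.Ioi 0, t ^ (α - 1) * Real.exp (-(r * t)) * f t := by
  have hm : Measurable (gammaPDF α r) := (measurable_gammaPDFReal α r).ennreal_ofReal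
  rw [gammaMeasure, integral_withDensity_eq_integral_toReal_smul hm (by simp [gammaPDF]),
    ← integral_const_mul, ← integral_Ici_eq_integral_Ioi, ← integral_indicator measurableSet_Ici]
  refine integral_congr_ae (.of_forall fun t => ?_)
  have hpdf : (gammaPDF α r t).toReal = gammaPDFReal α r t :=
    ENNReal.toReal_ofReal (gammaPDFReal_nonneg hα hr t)
  simp only [hpdf, gammaPDFReal, smul_eq_mul]
  by_cases ht : 0 ≤ t
  · rw [if_pos ht, Set.indicator_of_mem (Set.mem_Ici.2 ht)]
    ring
  · rw [if_neg ht, Set.indicator_of_notMem (by simpa using ht), zero_mul]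

theorem integral_exp_neg_pow_gammaMeasure {α : ℝ} (hα : 0 < α) (m : ℕ) :
    ∫ t, Real.exp (-t) ^ m ∂gammaMeasure α 1 = ((m : ℝ) + 1) ^ (-α) := by
  have hm : (0 : ℝ) < (m : ℝ) + 1 := by positivity
  have hexp (t : ℝ) : t ^ (α - 1) * Real.exp (-(1 * t)) * Real.exp (-t) ^ m =
      t ^ (α - 1) * Real.exp (-((m + 1) * t)) := by
    rw [← Real.exp_nat_mul, mul_assoc, ← Real.exp_add]
    ring_nf
  rw [integral_gammaMeasure hα one_pos]
  simp only [hexp]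
  rw [Real.integral_rpow_mul_exp_neg_mul_Ioi hα hm, Real.one_rpow, one_div_mul_eq_div,
    mul_div_cancel_right₀ _ (Real.Gamma_pos_of_pos hα).ne', one_div, Real.inv_rpow hm.le,
    Real.rpow_neg hm.le]

theorem setIntegral_exp_gammaMeasure {α : ℝ} (hα : 0 < α) :
    ∫ t in Set.Iic 1, Real.exp t ∂gammaMeasure α 1 = (Real.Gamma (α + 1))⁻¹ := by
  have hind : Set.EqOn (fun t => t ^ (α - 1) * Real.exp (-(1 * t)) *
      (Set.Iic 1).indicator Real.exp t) ((Set.Iic 1).indicator fun t => t ^ (α - 1))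
      (Set.Ioi 0) := fun t _ => by
    by_cases ht : t ∈ Set.Iic (1 : ℝ)
    · simp [Set.indicator_of_mem ht, mul_assoc, ← Real.exp_add]
    · simp [Set.indicator_of_notMem ht]
  rw [← integral_indicator measurableSet_Iic, integral_gammaMeasure hα one_pos,
    setIntegral_congr_fun measurableSet_Ioi hind, setIntegral_indicator measurableSet_Iic,
    Set.Ioi_inter_Iic, ← intervalIntegral.integral_of_le zero_le_one,
    integral_rpow (.inl (by linarith)), Real.Gamma_add_one hα.ne', sub_add_cancel,
    Real.zero_rpow hα.ne']
  simp [mul_comm]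

/-- The law of `exp (-T)` for a random variable `T` with the gamma distribution of shape `α` and
rate `1`: the limit law of Karamata's theorem. -/
noncomputable def expNegGammaLaw (α : ℝ) : Measure ℝ :=
  (gammaMeasure α 1).map fun t => Real.exp (-t)

theorem isProbabilityMeasure_expNegGammaLaw {α : ℝ} (hα : 0 < α) :
    IsProbabilityMeasure (expNegGammaLaw α) :=
  have := isProbabilityMeasure_gammaMeasure hα one_pos
  Measure.isProbabilityMeasure_map (by fun_prop)

theorem ae_expNegGammaLaw_mem_Icc (α : ℝ) : ∀ᵐ x ∂expNegGammaLaw α, x ∈ Set.Icc (0 : ℝ) 1 := by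
  refine (ae_map_iff (by fun_prop) measurableSet_Icc).2 ?_
  have h : ∀ᵐ t ∂gammaMeasure α 1, t ∉ Set.Iio 0 :=
    measure_eq_zero_iff_ae_notMem.1 (gammaMeasure_Iio_zero α 1)
  filter_upwards [h] with t ht
  exact ⟨(Real.exp_pos _).le, Real.exp_le_one_iff.2 (by simpa using ht)⟩

theorem integral_pow_expNegGammaLaw {α : ℝ} (hα : 0 < α) (m : ℕ) :
    ∫ x, x ^ m ∂expNegGammaLaw α = ((m : ℝ) + 1) ^ (-α) := by
  rw [expNegGammaLaw, integral_map (by fun_prop) (by fun_prop),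
    integral_exp_neg_pow_gammaMeasure hα]

theorem expNegGammaLaw_singleton (α x : ℝ) : expNegGammaLaw α {x} = 0 := by
  have hinj : Function.Injective fun t : ℝ => Real.exp (-t) :=
    Real.exp_injective.comp neg_injective
  rw [expNegGammaLaw, Measure.map_apply (by fun_prop) (measurableSet_singleton x)]
  exact withDensity_absolutelyContinuous _ _
    ((Set.subsingleton_singleton.preimage hinj).measure_zero volume)

end Gamma

section Karamata

variable {Ω : Type*} [MeasurableSpace Ω] {μ : Measure Ω} {X : Ω → ℝ}

/-- The law of `X ^ k` under the measure whose density with respect to `μ` is `k ^ α * X ^ k`. -/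
noncomputable def tiltedPowLaw (μ : Measure Ω) (X : Ω → ℝ) (α : ℝ) (k : ℕ) : Measure ℝ :=
  (μ.withDensity fun ω => ENNReal.ofReal ((k : ℝ) ^ α * X ω ^ k)).map fun ω => X ω ^ k

theorem integral_tiltedPowLaw (hX : Measurable X) (hX0 : ∀ ω, 0 ≤ X ω) (α : ℝ) (k : ℕ)
    {h : ℝ → ℝ} (hh : Measurable h) :
    ∫ x, h x ∂tiltedPowLaw μ X α k = (k : ℝ) ^ α * ∫ ω, X ω ^ k * h (X ω ^ k) ∂μ := by
  rw [tiltedPowLaw, integral_map (by fun_prop) hh.aestronglyMeasurable,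
    integral_withDensity_eq_integral_toReal_smul (by fun_prop) (by simp), ← integral_const_mul]
  refine integral_congr_ae (.of_forall fun ω => ?_)
  have h0 := hX0 ω
  simp only [smul_eq_mul]
  rw [ENNReal.toReal_ofReal (by positivity), mul_assoc]

theorem ae_tiltedPowLaw_mem_Icc (hX : Measurable X) (h01 : ∀ ω, X ω ∈ Set.Icc (0 : ℝ) 1)
    (α : ℝ) (k : ℕ) : ∀ᵐ x ∂tiltedPowLaw μ X α k, x ∈ Set.Icc (0 : ℝ) 1 :=
  (ae_map_iff (by fun_prop) measurableSet_Icc).2 <| .of_forall fun ω =>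
    ⟨pow_nonneg (h01 ω).1 k, pow_le_one₀ (h01 ω).1 (h01 ω).2⟩

theorem isFiniteMeasure_tiltedPowLaw [IsFiniteMeasure μ] (hX : Measurable X)
    (h01 : ∀ ω, X ω ∈ Set.Icc (0 : ℝ) 1) (α : ℝ) (k : ℕ) :
    IsFiniteMeasure (tiltedPowLaw μ X α k) := by
  have hint : Integrable (fun ω => X ω ^ k) μ := .of_bound (by fun_prop) 1 <|
    .of_forall fun ω => by
      rw [norm_pow, Real.norm_of_nonneg (h01 ω).1]
      exact pow_le_one₀ (h01 ω).1 (h01 ω).2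
  have := isFiniteMeasure_withDensity_ofReal (hint.const_mul ((k : ℝ) ^ α)).2
  exact Measure.isFiniteMeasure_map _ _

theorem tendsto_tiltedPowLaw_moment {α C : ℝ} (hX : Measurable X) (hX0 : ∀ ω, 0 ≤ X ω)
    (hC : Tendsto (fun k : ℕ => (k : ℝ) ^ α * ∫ ω, X ω ^ k ∂μ) atTop (𝓝 C)) (m : ℕ) :
    Tendsto (fun k : ℕ => ∫ x, x ^ m ∂tiltedPowLaw μ X α k) atTop
      (𝓝 (C * ((m : ℝ) + 1) ^ (-α))) := by
  have hsub : Tendsto (fun k : ℕ => k * (m + 1)) atTop atTop :=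
    tendsto_id.atTop_mul_const' (Nat.succ_pos m)
  refine ((hC.comp hsub).mul_const _).congr fun k => ?_
  rw [integral_tiltedPowLaw hX hX0 α k (h := fun x => x ^ m) (by fun_prop), Function.comp_apply]
  have hm : (0 : ℝ) < (m : ℝ) + 1 := by positivity
  push_cast
  rw [Real.mul_rpow k.cast_nonneg hm.le, Real.rpow_neg hm.le, mul_right_comm,
    mul_inv_cancel_right₀ (Real.rpow_pos_of_pos hm α).ne']
  congr 2
  funext ω
  ring

/- The integrand `1 / x` undoes the density of the tilted law; truncating it below the domain of
integration makes it bounded and continuous. -/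
theorem rpow_mul_measureReal_eq_setIntegral_tiltedPowLaw (hX : Measurable X)
    (hX0 : ∀ ω, 0 ≤ X ω) (α : ℝ) {k : ℕ} (hk : k ≠ 0) :
    (k : ℝ) ^ α * μ.real {ω | Real.exp (-(k : ℝ)⁻¹) ≤ X ω} =
      ∫ x in Set.Ici (Real.exp (-1)), (max x (Real.exp (-1)))⁻¹ ∂tiltedPowLaw μ X α k := by
  have hset : ∀ ω, ω ∈ {ω | Real.exp (-(k : ℝ)⁻¹) ≤ X ω} ↔
      X ω ^ k ∈ Set.Ici (Real.exp (-1)) := fun ω => by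
    have hk' : (k : ℝ) ≠ 0 := Nat.cast_ne_zero.2 hk
    rw [Set.mem_ofPred_eq, Set.mem_Ici, ← pow_le_pow_iff_left₀ (Real.exp_pos _).le (hX0 ω) hk,
      ← Real.exp_nat_mul, mul_neg, mul_inv_cancel₀ hk']
  rw [← integral_indicator measurableSet_Ici, integral_tiltedPowLaw hX hX0 α k
    (Measurable.indicator (by fun_prop) measurableSet_Ici),
    ← integral_indicator_one (measurableSet_le measurable_const hX)]
  congr 2
  funext ω
  by_cases hω : X ω ^ k ∈ Set.Ici (Real.exp (-1))
  · have hpos : 0 < X ω ^ k := (Real.exp_pos _).trans_le hω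
    rw [Set.indicator_of_mem ((hset ω).2 hω), Set.indicator_of_mem hω, max_eq_left hω,
      mul_inv_cancel₀ hpos.ne', Pi.one_apply]
  · rw [Set.indicator_of_notMem (mt (hset ω).1 hω), Set.indicator_of_notMem hω, mul_zero]

theorem setIntegral_inv_max_expNegGammaLaw {α : ℝ} (hα : 0 < α) :
    ∫ x in Set.Ici (Real.exp (-1)), (max x (Real.exp (-1)))⁻¹ ∂expNegGammaLaw α =
      (Real.Gamma (α + 1))⁻¹ := by
  have hpre : (fun t => Real.exp (-t)) ⁻¹' Set.Ici (Real.exp (-1)) = Set.Iic 1 := by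
    ext t
    simp
  rw [expNegGammaLaw, setIntegral_map measurableSet_Ici
    (Measurable.aestronglyMeasurable (by fun_prop)) (by fun_prop), hpre,
    ← setIntegral_exp_gammaMeasure hα]
  refine setIntegral_congr_fun measurableSet_Iic fun t ht => ?_
  rw [Real.exp_neg t, max_eq_left (by rw [← Real.exp_neg]; simpa using ht), inv_inv]

open scoped BoundedContinuousFunction in
theorem tendsto_rpow_mul_measureReal_exp_neg_inv_le {α C : ℝ} [IsFiniteMeasure μ] (hα : 0 < α)
    (hX : Measurable X) (h01 : ∀ ω, X ω ∈ Set.Icc (0 : ℝ) 1)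
    (hC : Tendsto (fun k : ℕ => (k : ℝ) ^ α * ∫ ω, X ω ^ k ∂μ) atTop (𝓝 C)) :
    Tendsto (fun k : ℕ => (k : ℝ) ^ α * μ.real {ω | Real.exp (-(k : ℝ)⁻¹) ≤ X ω}) atTop
      (𝓝 (C / Real.Gamma (α + 1))) := by
  have hX0 ω : 0 ≤ X ω := (h01 ω).1
  have hC0 : 0 ≤ C := ge_of_tendsto' hC fun k =>
    mul_nonneg (by positivity) (integral_nonneg fun ω => pow_nonneg (hX0 ω) k)
  have := isFiniteMeasure_tiltedPowLaw (μ := μ) hX h01 α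
  have := isProbabilityMeasure_expNegGammaLaw hα
  let ν₀ : Measure ℝ := C.toNNReal • expNegGammaLaw α
  have hint (h : ℝ → ℝ) (s : Set ℝ) :
      ∫ x in s, h x ∂ν₀ = C * ∫ x in s, h x ∂expNegGammaLaw α := by
    rw [Measure.restrict_smul, integral_smul_nnreal_measure, NNReal.smul_def,
      Real.coe_toNNReal C hC0, smul_eq_mul]
  have hweak (h : ℝ →ᵇ ℝ) : Tendsto (fun k => ∫ x, h x ∂tiltedPowLaw μ X α k) atTop
      (𝓝 (∫ x, h x ∂ν₀)) := by
    refine tendsto_integral_continuous_of_tendsto_moments (ae_tiltedPowLaw_mem_Icc hX h01 α)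
      (Measure.ae_smul_measure (ae_expNegGammaLaw_mem_Icc α) _) (fun m => ?_) h.continuous
    rw [← setIntegral_univ, hint, setIntegral_univ, integral_pow_expNegGammaLaw hα]
    exact tendsto_tiltedPowLaw_moment hX hX0 hC m
  have hg : Continuous fun x : ℝ => (max x (Real.exp (-1)))⁻¹ := by
    fun_prop (disch := intro x; positivity)
  let g : ℝ →ᵇ ℝ := .ofNormedAddCommGroup _ hg (Real.exp (-1))⁻¹ fun x => by
    rw [norm_inv, Real.norm_of_nonneg (by positivity)]
    gcongr
    exact le_max_right _ _
  have hfront : ν₀ (frontier (Set.Ici (Real.exp (-1)))) = 0 := by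
    simp [ν₀, expNegGammaLaw_singleton]
  have hlim := tendsto_setIntegral_of_null_frontier hweak (g := g) (fun x => by
    change 0 ≤ (max x (Real.exp (-1)))⁻¹
    positivity) measurableSet_Ici hfront
  rw [hint] at hlim
  rw [div_eq_mul_inv, ← setIntegral_inv_max_expNegGammaLaw hα]
  exact hlim.congr' ((eventually_ne_atTop 0).mono fun k hk =>
    (rpow_mul_measureReal_eq_setIntegral_tiltedPowLaw hX hX0 α hk).symm)

theorem tendsto_div_rpow_of_tendsto_rpow_mul_inv {F : ℝ → ℝ} {α L : ℝ} (hF : Monotone F)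
    (hF0 : ∀ r, 0 ≤ F r) (hα : 0 ≤ α)
    (h : Tendsto (fun k : ℕ => (k : ℝ) ^ α * F (k : ℝ)⁻¹) atTop (𝓝 L)) :
    Tendsto (fun r => F r / r ^ α) (𝓝[>] 0) (𝓝 L) := by
  have hfloor : Tendsto (fun r : ℝ => ⌊r⁻¹⌋₊) (𝓝[>] 0) atTop :=
    tendsto_nat_floor_atTop.comp tendsto_inv_nhdsGT_zero
  have hratio : Tendsto (fun k : ℕ => ((k : ℝ) / (k + 1)) ^ α) atTop (𝓝 1) := by
    simpa using tendsto_natCast_div_add_atTop (1 : ℝ) |>.rpow_const (p := α) (.inl one_ne_zero)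
  have hlower : Tendsto (fun k : ℕ => (k : ℝ) ^ α * F ((k : ℝ) + 1)⁻¹) atTop (𝓝 L) := by
    have := (h.comp (tendsto_add_atTop_nat 1)).mul hratio
    rw [mul_one] at this
    refine this.congr fun k => ?_
    have hk : (0 : ℝ) < (k : ℝ) + 1 := by positivity
    simp only [Function.comp_apply, Nat.cast_add, Nat.cast_one]
    rw [Real.div_rpow k.cast_nonneg hk.le]
    field_simp
  have hupper : Tendsto (fun k : ℕ => ((k : ℝ) + 1) ^ α * F (k : ℝ)⁻¹) atTop (𝓝 L) := by
    have := h.div hratio one_ne_zero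
    rw [div_one] at this
    refine this.congr' ((eventually_ne_atTop 0).mono fun k hk => ?_)
    have hk : (0 : ℝ) < k := by positivity
    rw [Pi.div_apply, Real.div_rpow hk.le (by positivity)]
    field_simp
  refine tendsto_of_tendsto_of_tendsto_of_le_of_le' (hlower.comp hfloor) (hupper.comp hfloor) ?_ ?_
  all_goals
    filter_upwards [self_mem_nhdsWithin, hfloor.eventually_ge_atTop 1] with r (hr : 0 < r) hk
    rw [div_eq_mul_inv, ← Real.inv_rpow hr.le, mul_comm (F r)]
    have hk0 : (0 : ℝ) < ⌊r⁻¹⌋₊ := by exact_mod_cast hk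
    have hle : (⌊r⁻¹⌋₊ : ℝ) ≤ r⁻¹ := Nat.floor_le (by positivity)
    have hlt : r⁻¹ < (⌊r⁻¹⌋₊ : ℝ) + 1 := Nat.lt_floor_add_one _
    have := hF0 r
  · exact mul_le_mul (by gcongr) (hF (inv_le_of_inv_le₀ hr hlt.le)) (hF0 _) (by positivity)
  · exact mul_le_mul (by gcongr) (hF ((le_inv_comm₀ hk0 hr).1 hle)) (hF0 _) (by positivity)

theorem tendsto_measureReal_exp_neg_le_div_rpow {α C : ℝ} [IsFiniteMeasure μ] (hα : 0 < α)
    (hX : Measurable X) (h01 : ∀ ω, X ω ∈ Set.Icc (0 : ℝ) 1)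
    (hC : Tendsto (fun k : ℕ => (k : ℝ) ^ α * ∫ ω, X ω ^ k ∂μ) atTop (𝓝 C)) :
    Tendsto (fun r : ℝ => μ.real {ω | Real.exp (-r) ≤ X ω} / r ^ α) (𝓝[>] 0)
      (𝓝 (C / Real.Gamma (α + 1))) := by
  refine tendsto_div_rpow_of_tendsto_rpow_mul_inv (fun r s hrs => ?_)
    (fun _ => measureReal_nonneg) hα.le (tendsto_rpow_mul_measureReal_exp_neg_inv_le hα hX h01 hC)
  exact measureReal_mono fun ω hω =>
    (Real.exp_le_exp.2 (neg_le_neg hrs)).trans (show _ ≤ X ω from hω)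

end Karamata

section UnitaryGroup

variable {ι : Type*} [Fintype ι] [DecidableEq ι]

theorem compactSpace_unitaryGroup : CompactSpace (Matrix.unitaryGroup ι ℂ) := by
  have hball : IsCompact (X := Matrix ι ι ℂ)
      (Set.univ.pi fun _ => Set.univ.pi fun _ => Metric.closedBall 0 1) :=
    isCompact_univ_pi fun _ => isCompact_univ_pi fun _ => isCompact_closedBall 0 1
  refine isCompact_iff_compactSpace.1 (hball.of_isClosed_subset isClosed_unitary
    fun M hM i _ j _ => ?_)
  simpa using entry_norm_bound_of_unitary hM i j

theorem secondCountableTopology_unitaryGroup :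
    SecondCountableTopology (Matrix.unitaryGroup ι ℂ) :=
  have : SecondCountableTopology (Matrix ι ι ℂ) :=
    inferInstanceAs (SecondCountableTopology (ι → ι → ℂ))
  TopologicalSpace.Subtype.secondCountableTopology _

theorem continuous_unitaryGroup_apply (i j : ι) :
    Continuous fun U : Matrix.unitaryGroup ι ℂ => U.1 i j :=
  continuous_subtype_val.matrix_elem i j

theorem exists_unitary_col (i : ι) {w : EuclideanSpace ℂ ι} (hw : ‖w‖ = 1) :
    ∃ V : Matrix.unitaryGroup ι ℂ, ∀ l, V.1 l i = w l := by
  obtain ⟨b, hb⟩ := Orthonormal.exists_orthonormalBasis_extension_of_card_eq (𝕜 := ℂ)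
    (E := EuclideanSpace ℂ ι) (ι := ι) (by simp) (v := fun _ => w) (s := {i})
    ⟨fun _ => hw, fun _ _ hij => (hij (Subsingleton.elim _ _)).elim⟩
  refine ⟨⟨_, (EuclideanSpace.basisFun ι ℂ).toMatrix_orthonormalBasis_mem_unitary b⟩, fun l => ?_⟩
  simp [Module.Basis.toMatrix_apply, hb i rfl]

theorem diagonal_mem_unitaryGroup {d : ι → ℂ} (hd : ∀ i, ‖d i‖ = 1) :
    Matrix.diagonal d ∈ Matrix.unitaryGroup ι ℂ := by
  rw [Matrix.mem_unitaryGroup_iff, Matrix.star_eq_conjTranspose, Matrix.diagonal_conjTranspose,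
    Matrix.diagonal_mul_diagonal, Matrix.diagonal_eq_one]
  funext i
  exact (Complex.mul_conj' (d i)).trans (by simp [hd i])

theorem unitary_star_mul_apply (U : Matrix.unitaryGroup ι ℂ) (i j : ι) :
    ∑ l, star (U.1 l i) * U.1 l j = (1 : Matrix ι ι ℂ) i j := by
  rw [← Matrix.mem_unitaryGroup_iff'.1 U.2, Matrix.mul_apply]
  rfl

theorem unitary_col_norm_sq_sum (U : Matrix.unitaryGroup ι ℂ) (i : ι) :
    ∑ l, ‖U.1 l i‖ ^ 2 = 1 := by
  have h := unitary_star_mul_apply U i i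
  simp only [RCLike.star_def, Complex.conj_mul', Matrix.one_apply_eq] at h
  exact_mod_cast h

end UnitaryGroup

section Phase

variable {X : Type*} [MeasurableSpace X] {μ : Measure X}

theorem integrable_of_continuous_of_compactSpace [TopologicalSpace X] [CompactSpace X]
    [OpensMeasurableSpace X] [IsFiniteMeasure μ] {E : Type*} [NormedAddCommGroup E]
    {f : X → E} (hf : Continuous f) : Integrable f μ :=
  hf.integrable_of_hasCompactSupport (.of_compactSpace f)

theorem pow_mul_star_pow_ne_one {ζ : ℂ} {n i j : ℕ} (hζ : IsPrimitiveRoot ζ n) (hi : i < n)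
    (hj : j < n) (hij : i ≠ j) : ζ ^ i * star ζ ^ j ≠ 1 := by
  intro h
  have hnorm : ‖ζ‖ = 1 := hζ.norm'_eq_one (by omega)
  have hstar : star ζ * ζ = 1 := (Complex.conj_mul' ζ).trans (by simp [hnorm])
  refine hij (hζ.pow_inj hi hj ?_)
  calc ζ ^ i = ζ ^ i * (star ζ * ζ) ^ j := by rw [hstar, one_pow, mul_one]
    _ = (ζ ^ i * star ζ ^ j) * ζ ^ j := by rw [mul_pow, mul_assoc]
    _ = ζ ^ j := by rw [h, one_mul]

/-- The joint law of `(f, g)` does not change when `g` is multiplied by a phase. -/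
def IsPhaseInvariant (μ : Measure X) (f g : X → ℂ) : Prop :=
  ∀ ζ : ℂ, ‖ζ‖ = 1 →
    ProbabilityTheory.IdentDistrib (fun x => (f x, ζ * g x)) (fun x => (f x, g x)) μ μ

variable {f g : X → ℂ}

theorem IsPhaseInvariant.const_mul (h : IsPhaseInvariant μ f g) (t : ℂ) :
    IsPhaseInvariant μ f fun x => t * g x := fun ζ hζ => by
  simpa only [Function.comp_def, mul_left_comm t ζ] using
    (h ζ hζ).comp (u := fun p : ℂ × ℂ => (p.1, t * p.2)) (by fun_prop)

theorem IsPhaseInvariant.integral_cross_term_eq_zero (h : IsPhaseInvariant μ f g) {i j : ℕ}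
    (hij : i ≠ j) (a b : ℕ) :
    ∫ x, g x ^ i * f x ^ a * (star (g x) ^ j * star (f x) ^ b) ∂μ = 0 := by
  have hprim := Complex.isPrimitiveRoot_exp (max i j + 1) (Nat.succ_ne_zero _)
  set ζ := Complex.exp (2 * Real.pi * Complex.I / ((max i j + 1 : ℕ) : ℂ))
  have hne : ζ ^ i * star ζ ^ j ≠ 1 := pow_mul_star_pow_ne_one hprim (by omega) (by omega) hij
  have hrot := ((h ζ (hprim.norm'_eq_one (Nat.succ_ne_zero _))).comp
    (u := fun p : ℂ × ℂ => p.2 ^ i * p.1 ^ a * (star p.2 ^ j * star p.1 ^ b))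
    (by fun_prop)).integral_eq
  have hmul : ∀ x, (ζ * g x) ^ i * f x ^ a * (star (ζ * g x) ^ j * star (f x) ^ b) =
      ζ ^ i * star ζ ^ j * (g x ^ i * f x ^ a * (star (g x) ^ j * star (f x) ^ b)) := fun x => by
    rw [star_mul']
    ring
  simp only [Function.comp_def, hmul, integral_const_mul] at hrot
  by_contra hI
  exact hne (mul_right_cancel₀ hI (hrot.trans (one_mul _).symm))

theorem IsPhaseInvariant.integral_norm_add_pow [TopologicalSpace X] [CompactSpace X]
    [OpensMeasurableSpace X] [IsFiniteMeasure μ] (h : IsPhaseInvariant μ f g) (hf : Continuous f)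
    (hg : Continuous g) (k : ℕ) :
    ∫ x, ‖f x + g x‖ ^ (2 * k) ∂μ =
      ∑ m ∈ Finset.range (k + 1), (k.choose m : ℝ) ^ 2 *
        ∫ x, ‖f x‖ ^ (2 * (k - m)) * ‖g x‖ ^ (2 * m) ∂μ := by
  have hnorm (z : ℂ) (m : ℕ) : ((‖z‖ ^ (2 * m) : ℝ) : ℂ) = z ^ m * star z ^ m := by
    rw [← mul_pow, pow_mul, RCLike.star_def, Complex.mul_conj']
    push_cast
    rfl
  let Φ (i j : ℕ) (x : X) : ℂ := g x ^ i * f x ^ (k - i) * (star (g x) ^ j * star (f x) ^ (k - j))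
  have hint (i j : ℕ) : Integrable (fun x => (k.choose i * k.choose j : ℂ) * Φ i j x) μ :=
    integrable_of_continuous_of_compactSpace (by fun_prop)
  have hexp (x : X) : ((‖f x + g x‖ ^ (2 * k) : ℝ) : ℂ) =
      ∑ i ∈ Finset.range (k + 1), ∑ j ∈ Finset.range (k + 1),
        (k.choose i * k.choose j : ℂ) * Φ i j x := by
    rw [hnorm, star_add, add_comm (f x), add_comm (star (f x)), add_pow, add_pow,
      Finset.sum_mul_sum]
    refine Finset.sum_congr rfl fun i _ => Finset.sum_congr rfl fun j _ => ?_
    ring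
  apply Complex.ofReal_injective
  simp only [← integral_complex_ofReal, hexp]
  rw [integral_finsetSum _ fun i _ => integrable_finsetSum _ fun j _ => hint i j]
  push_cast
  refine Finset.sum_congr rfl fun i hi => ?_
  rw [integral_finsetSum _ fun j _ => hint i j, Finset.sum_eq_single_of_mem i hi fun j _ hji => by
    rw [integral_const_mul, h.integral_cross_term_eq_zero hji.symm, mul_zero]]
  rw [integral_const_mul, ← integral_complex_ofReal, sq]
  congr 2
  funext x
  rw [Complex.ofReal_mul, hnorm, hnorm]
  ring

theorem identDistrib_comp_mul_left {G β : Type*} [Group G] [MeasurableSpace G] [MeasurableMul G]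
    [MeasurableSpace β] (μ : Measure G) [μ.IsMulLeftInvariant] {F : G → β} (hF : Measurable F)
    (v : G) : ProbabilityTheory.IdentDistrib (fun x => F (v * x)) F μ μ where
  aemeasurable_fst := (hF.comp (measurable_const_mul v)).aemeasurable
  aemeasurable_snd := hF.aemeasurable
  map_eq := by
    change μ.map (F ∘ (v * ·)) = μ.map F
    rw [← Measure.map_map hF (measurable_const_mul v), map_mul_left_eq_self]

end Phase

section EntryMoments

attribute [local instance] compactSpace_unitaryGroup secondCountableTopology_unitaryGroup

theorem eq_mul_choose_of_sum_mul_pow_eq {a : ℕ → ℝ} {M : ℝ} {k : ℕ}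
    (h : ∀ s, 0 ≤ s → ∑ m ∈ Finset.range (k + 1), a m * s ^ m = M * (1 + s) ^ k) {m : ℕ}
    (hm : m ≤ k) : a m = M * k.choose m := by
  have hpoly : ∑ m ∈ Finset.range (k + 1), Polynomial.C (a m) * Polynomial.X ^ m =
      Polynomial.C M * (1 + Polynomial.X) ^ k :=
    Polynomial.eq_of_infinite_eval_eq _ _ <| (Set.Ici_infinite (0 : ℝ)).mono fun s hs => by
      simpa [Polynomial.eval_finsetSum] using h s hs
  have hcoeff := congrArg (Polynomial.coeff · m) hpoly
  simp only [Polynomial.finsetSum_coeff, Polynomial.coeff_C_mul, Polynomial.coeff_X_pow,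
    Polynomial.coeff_one_add_X_pow] at hcoeff
  rw [Finset.sum_eq_single_of_mem m (by simpa using Nat.lt_succ_iff.2 hm)
    fun l _ hl => by simp [hl.symm]] at hcoeff
  simpa using hcoeff

theorem sum_choose_sq_mul_factorial_div (n k : ℕ) :
    ∑ m ∈ Finset.range (k + 1), (k.choose m : ℝ) ^ 2 * ((m ! : ℝ) * n ! / (n + m)!) =
      ((2 * k + n)! : ℝ) * n ! / ((k + n)! : ℝ) ^ 2 := by
  have hterm : ∀ m ∈ Finset.range (k + 1), (k.choose m : ℝ) ^ 2 * ((m ! : ℝ) * n ! / (n + m)!) =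
      (k ! : ℝ) * n ! / (k + n)! * ((k.choose m * (k + n).choose (k - m) : ℕ) : ℝ) := by
    intro m hm
    have hmk : m ≤ k := Nat.lt_succ_iff.1 (Finset.mem_range.1 hm)
    push_cast
    rw [Nat.cast_choose ℝ hmk, Nat.cast_choose ℝ (show k - m ≤ k + n by omega),
      show k + n - (k - m) = n + m by omega]
    field_simp
  have hvandermonde := Nat.add_choose_eq k (k + n) k
  rw [Finset.Nat.sum_antidiagonal_eq_sum_range_succ_mk] at hvandermonde
  rw [Finset.sum_congr rfl hterm, ← Finset.mul_sum, ← Nat.cast_sum, ← hvandermonde,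
    Nat.cast_choose ℝ (show k ≤ k + (k + n) by omega), show k + (k + n) - k = k + n by omega,
    show k + (k + n) = 2 * k + n by ring]
  field_simp

theorem norm_mulSingle_apply {ι : Type*} [DecidableEq ι] {j : ι} {ζ : ℂ} (hζ : ‖ζ‖ = 1) (l : ι) :
    ‖(Pi.mulSingle j ζ : ι → ℂ) l‖ = 1 := by
  rcases eq_or_ne l j with rfl | hl
  · rwa [Pi.mulSingle_eq_same]
  · rw [Pi.mulSingle_eq_of_ne hl, norm_one]

variable {ι : Type*} [Fintype ι] [DecidableEq ι] [MeasurableSpace (Matrix.unitaryGroup ι ℂ)]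
  [BorelSpace (Matrix.unitaryGroup ι ℂ)] (σ : Measure (Matrix.unitaryGroup ι ℂ))
  [σ.IsMulLeftInvariant]

theorem integral_norm_inner_unitary_col_pow {w : EuclideanSpace ℂ ι} (hw : ‖w‖ = 1) (i j : ι)
    (k : ℕ) : ∫ U, ‖∑ l, star (w l) * U.1 l j‖ ^ k ∂σ = ∫ U, ‖U.1 i j‖ ^ k ∂σ := by
  obtain ⟨V, hV⟩ := exists_unitary_col i hw
  rw [← integral_mul_left_eq_self (μ := σ) (fun U => ‖U.1 i j‖ ^ k) (star V)]
  congr 1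
  funext U
  rw [Matrix.UnitaryGroup.mul_apply]
  simp [Matrix.mul_apply, hV]

theorem integral_norm_entry_add_mul_entry_pow {i j : ι} (hij : i ≠ j) (l : ι) (t : ℝ) (k : ℕ) :
    ∫ U, ‖U.1 i l + t * U.1 j l‖ ^ (2 * k) ∂σ =
      (1 + t ^ 2) ^ k * ∫ U, ‖U.1 i l‖ ^ (2 * k) ∂σ := by
  have hs : 0 < 1 + t ^ 2 := by positivity
  set c : ℝ := √(1 + t ^ 2)
  have hc0 : 0 < c := Real.sqrt_pos.2 hs
  have hc2 : c ^ 2 = 1 + t ^ 2 := Real.sq_sqrt hs.le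
  let v : EuclideanSpace ℂ ι := EuclideanSpace.single i 1 + EuclideanSpace.single j (t : ℂ)
  have hv : ‖v‖ = c := by
    rw [← pow_left_inj₀ (norm_nonneg _) hc0.le two_ne_zero, hc2, @norm_add_sq ℂ,
      EuclideanSpace.inner_single_left]
    simp [hij.symm]
  have hw : ‖(c⁻¹ : ℂ) • v‖ = 1 := by
    rw [norm_smul, hv, norm_inv, Complex.norm_real, Real.norm_of_nonneg hc0.le,
      inv_mul_cancel₀ hc0.ne']
  have hentry (U : Matrix.unitaryGroup ι ℂ) :
      ∑ m, star (((c⁻¹ : ℂ) • v) m) * U.1 m l = (c⁻¹ : ℂ) * (U.1 i l + t * U.1 j l) := by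
    simp only [v, PiLp.smul_apply, PiLp.add_apply, PiLp.single_apply, smul_eq_mul, star_mul',
      star_add, apply_ite star, star_one, star_zero, add_mul, mul_add, Finset.sum_add_distrib]
    simp [mul_assoc]
  rw [← integral_norm_inner_unitary_col_pow σ hw i l, ← integral_const_mul]
  congr 1
  funext U
  rw [hentry, norm_mul, norm_inv, Complex.norm_real, Real.norm_of_nonneg hc0.le, mul_pow, inv_pow,
    ← hc2, pow_mul c, mul_inv_cancel_left₀ (by positivity)]

theorem isPhaseInvariant_entry_entry {i j : ι} (hij : i ≠ j) (l : ι) :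
    IsPhaseInvariant σ (fun U => U.1 i l) fun U => U.1 j l := fun ζ hζ => by
  have h := identDistrib_comp_mul_left σ (F := fun U => (U.1 i l, U.1 j l))
    ((continuous_unitaryGroup_apply i l).prodMk (continuous_unitaryGroup_apply j l)).measurable
    ⟨_, diagonal_mem_unitaryGroup (norm_mulSingle_apply (j := j) hζ)⟩
  simpa [Matrix.diagonal_mul, hij] using h

theorem isPhaseInvariant_one_entry (i j : ι) :
    IsPhaseInvariant σ (fun _ => 1) fun U => U.1 i j := fun ζ hζ => by
  have h := identDistrib_comp_mul_left σ (F := fun U => ((1 : ℂ), U.1 i j))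
    (measurable_const.prodMk (continuous_unitaryGroup_apply i j).measurable)
    ⟨_, diagonal_mem_unitaryGroup fun _ : ι => hζ⟩
  simpa [Matrix.diagonal_mul] using h

theorem choose_mul_integral_norm_entry_pow_mul_norm_entry_pow [IsFiniteMeasure σ] {i j : ι}
    (hij : i ≠ j) (l : ι) {k m : ℕ} (hm : m ≤ k) :
    (k.choose m : ℝ) * ∫ U, ‖U.1 i l‖ ^ (2 * (k - m)) * ‖U.1 j l‖ ^ (2 * m) ∂σ =
      ∫ U, ‖U.1 i l‖ ^ (2 * k) ∂σ := by
  have hbinom (s : ℝ) (hs : 0 ≤ s) : ∑ m ∈ Finset.range (k + 1), (k.choose m : ℝ) ^ 2 *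
      (∫ U, ‖U.1 i l‖ ^ (2 * (k - m)) * ‖U.1 j l‖ ^ (2 * m) ∂σ) * s ^ m =
        (∫ U, ‖U.1 i l‖ ^ (2 * k) ∂σ) * (1 + s) ^ k := by
    have hrot := integral_norm_entry_add_mul_entry_pow σ hij l (√s) k
    rw [((isPhaseInvariant_entry_entry σ hij l).const_mul _).integral_norm_add_pow
      (continuous_unitaryGroup_apply i l)
      (continuous_const.mul (continuous_unitaryGroup_apply j l)), Real.sq_sqrt hs, mul_comm] at hrot
    rw [← hrot]
    refine Finset.sum_congr rfl fun m _ => ?_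
    rw [mul_assoc, ← integral_mul_const]
    congr 3
    funext U
    rw [norm_mul, mul_pow, Complex.norm_real, Real.norm_of_nonneg (Real.sqrt_nonneg s), pow_mul √s,
      Real.sq_sqrt hs]
    ring
  have hcoeff := eq_mul_choose_of_sum_mul_pow_eq hbinom hm
  have hpos : (k.choose m : ℝ) ≠ 0 := Nat.cast_ne_zero.2 (Nat.choose_pos hm).ne'
  exact mul_left_cancel₀ hpos (by linear_combination hcoeff)

theorem integral_norm_entry_pow_succ [IsFiniteMeasure σ] (i l : ι) (k : ℕ) :
    ((k : ℝ) + Fintype.card ι) * ∫ U, ‖U.1 i l‖ ^ (2 * (k + 1)) ∂σ =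
      ((k : ℝ) + 1) * ∫ U, ‖U.1 i l‖ ^ (2 * k) ∂σ := by
  have hcont (j : ι) : Continuous fun U : Matrix.unitaryGroup ι ℂ => U.1 j l :=
    continuous_unitaryGroup_apply j l
  have hcol : ∫ U, ‖U.1 i l‖ ^ (2 * k) ∂σ =
      ∑ j, ∫ U, ‖U.1 i l‖ ^ (2 * k) * ‖U.1 j l‖ ^ 2 ∂σ := by
    have hint (j : ι) :
        Integrable (fun U : Matrix.unitaryGroup ι ℂ => ‖U.1 i l‖ ^ (2 * k) * ‖U.1 j l‖ ^ 2) σ :=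
      integrable_of_continuous_of_compactSpace (((hcont i).norm.pow _).mul ((hcont j).norm.pow _))
    rw [← integral_finsetSum _ fun j _ => hint j]
    simp only [← Finset.mul_sum, unitary_col_norm_sq_sum, mul_one]
  have hoff (j : ι) (hj : j ∈ Finset.univ.erase i) :
      ((k : ℝ) + 1) * ∫ U, ‖U.1 i l‖ ^ (2 * k) * ‖U.1 j l‖ ^ 2 ∂σ =
        ∫ U, ‖U.1 i l‖ ^ (2 * (k + 1)) ∂σ := by
    simpa using choose_mul_integral_norm_entry_pow_mul_norm_entry_pow σ
      (Finset.ne_of_mem_erase hj).symm l (Nat.le_add_left 1 k)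
  have hcard : ((Finset.univ.erase i).card : ℝ) + 1 = Fintype.card ι := by
    exact_mod_cast Finset.card_erase_add_one (Finset.mem_univ i)
  have hdiag (U : Matrix.unitaryGroup ι ℂ) :
      ‖U.1 i l‖ ^ (2 * k) * ‖U.1 i l‖ ^ 2 = ‖U.1 i l‖ ^ (2 * (k + 1)) := by ring
  rw [hcol, Finset.mul_sum, ← Finset.add_sum_erase _ _ (Finset.mem_univ i),
    Finset.sum_congr rfl hoff, Finset.sum_const, nsmul_eq_mul, ← hcard]
  simp only [hdiag]
  ring

variable [IsProbabilityMeasure σ]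

theorem integral_norm_entry_pow {n : ℕ} (hn : Fintype.card ι = n + 1) (i j : ι) (k : ℕ) :
    ∫ U, ‖U.1 i j‖ ^ (2 * k) ∂σ = (k ! : ℝ) * n ! / (n + k)! := by
  induction k with
  | zero =>
    have : (n ! : ℝ) ≠ 0 := by positivity
    simp [this]
  | succ k ih =>
    have h := integral_norm_entry_pow_succ σ i j k
    rw [ih, hn] at h
    have hne : (k : ℝ) + (n + 1 : ℕ) ≠ 0 := by positivity
    apply mul_left_cancel₀ hne
    rw [h, Nat.factorial_succ k, ← add_assoc, Nat.factorial_succ (n + k)]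
    push_cast
    field_simp
    ring

theorem integral_norm_one_add_entry_pow {n : ℕ} (hn : Fintype.card ι = n + 1) (i j : ι) (k : ℕ) :
    ∫ U, ‖1 + U.1 i j‖ ^ (2 * k) ∂σ = ((2 * k + n)! : ℝ) * n ! / ((k + n)! : ℝ) ^ 2 := by
  rw [(isPhaseInvariant_one_entry σ i j).integral_norm_add_pow continuous_const
    (continuous_unitaryGroup_apply i j), ← sum_choose_sq_mul_factorial_div]
  simp [integral_norm_entry_pow σ hn]

end EntryMoments

section Independence

open ProbabilityTheory

variable {G H : Type*} [Group G] [MeasurableSpace G] [MeasurableMul G] [Group H]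
  [MeasurableSpace H] {μ : Measure G} [μ.IsMulLeftInvariant] {ρ : G → H} {θ : H → G}

theorem isMulLeftInvariant_map_restrict_of_equivariant [MeasurableMul H] (hρ : Measurable ρ)
    (hθ : ∀ h x, ρ (θ h * x) = h * ρ x) {s : Set G} (hs : ∀ h x, θ h * x ∈ s ↔ x ∈ s) :
    ((μ.restrict s).map ρ).IsMulLeftInvariant := ⟨fun h => by
  have hcomp : (h * ·) ∘ ρ = ρ ∘ (θ h * ·) := funext fun x => (hθ h x).symm
  have hrestrict : (μ.restrict s).map (θ h * ·) = μ.restrict s := by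
    have hpre : (θ h * ·) ⁻¹' s = s := Set.ext fun x => hs h x
    conv_lhs => rw [← hpre]
    rw [← (measurableEmbedding_mulLeft (θ h)).restrict_map, map_mul_left_eq_self]
  rw [Measure.map_map (measurable_const_mul h) hρ, hcomp,
    ← Measure.map_map hρ (measurable_const_mul (θ h)), hrestrict]⟩

theorem isMulLeftInvariant_map_of_equivariant [MeasurableMul H] (hρ : Measurable ρ)
    (hθ : ∀ h x, ρ (θ h * x) = h * ρ x) : (μ.map ρ).IsMulLeftInvariant := by
  simpa using isMulLeftInvariant_map_restrict_of_equivariant (μ := μ) hρ hθ (s := Set.univ)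

/- Conditionally on any event of `f`, the law of `ρ` is still left invariant, hence unchanged up to
a scalar. -/
theorem indepFun_of_equivariant [MeasurableMul₂ H] [MeasurableInv H] [IsProbabilityMeasure μ]
    (hρ : Measurable ρ) (hθ : ∀ h x, ρ (θ h * x) = h * ρ x) {β : Type*} [MeasurableSpace β]
    {f : G → β} (hfθ : ∀ h x, f (θ h * x) = f x) : IndepFun f ρ μ := by
  rw [indepFun_iff_measure_inter_preimage_eq_mul]
  intro A B _ hB
  have hcond := isMulLeftInvariant_map_restrict_of_equivariant (μ := μ) hρ hθ (s := f ⁻¹' A)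
    fun h x => by simp only [Set.mem_preimage, hfθ]
  have hinv := isMulLeftInvariant_map_of_equivariant (μ := μ) hρ hθ
  have hprob := Measure.isProbabilityMeasure_map (μ := μ) hρ.aemeasurable
  have huniq := measure_mul_measure_eq ((μ.restrict (f ⁻¹' A)).map ρ) (μ.map ρ) Set.univ B
    (by simp) (by simp)
  simpa [Measure.map_apply hρ, hB, hρ hB, Set.inter_comm, eq_comm] using huniq

end Independence

section SchurReduction

attribute [local instance] compactSpace_unitaryGroup secondCountableTopology_unitaryGroup

theorem unitary_apply_eq_zero_of_norm_eq_one {ι : Type*} [Fintype ι] [DecidableEq ι]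
    (U : Matrix.unitaryGroup ι ℂ) {i j l : ι} (hij : ‖U.1 i j‖ = 1) (hl : l ≠ j) :
    U.1 i l = 0 := by
  have hrow : ∑ m, ‖U.1 i m‖ ^ 2 = 1 := by
    simpa [Matrix.star_apply] using unitary_col_norm_sq_sum (star U) i
  rw [← Finset.add_sum_erase _ _ (Finset.mem_univ j), hij, one_pow, add_eq_left,
    Finset.sum_eq_zero_iff_of_nonneg fun m _ => by positivity] at hrow
  simpa using hrow l (Finset.mem_erase.2 ⟨hl, Finset.mem_univ l⟩)

variable {n : ℕ}

/-- The coefficient `z` such that adding `z` times the column `0` to the column `j + 1` of `1 + U`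
clears its first entry. If `1 + U 0 0 = 0`, then that entry already vanishes by unitarity, and
division by zero gives the correct value `z = 0`. -/
noncomputable def clearCoeff (U : Matrix.unitaryGroup (Fin (n + 1)) ℂ) (j : Fin n) : ℂ :=
  -(U.1 0 j.succ / (1 + U.1 0 0))

theorem row_zero_eq_neg_mul_clearCoeff (U : Matrix.unitaryGroup (Fin (n + 1)) ℂ) (j : Fin n) :
    U.1 0 j.succ = -((1 + U.1 0 0) * clearCoeff U j) := by
  by_cases h : 1 + U.1 0 0 = 0
  · have hnorm : ‖U.1 0 0‖ = 1 := by rw [← neg_eq_of_add_eq_zero_right h, norm_neg, norm_one]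
    rw [unitary_apply_eq_zero_of_norm_eq_one U hnorm j.succ_ne_zero, h, zero_mul, neg_zero]
  · unfold clearCoeff
    field_simp

theorem schurReduce_mem_unitaryGroup (U : Matrix.unitaryGroup (Fin (n + 1)) ℂ) :
    (Matrix.of fun i j : Fin n => U.1 i.succ j.succ + U.1 i.succ 0 * clearCoeff U j) ∈
      Matrix.unitaryGroup (Fin n) ℂ := by
  rw [Matrix.mem_unitaryGroup_iff']
  ext i j
  set z := clearCoeff U
  have hrow (j : Fin n) : U.1 0 j.succ + U.1 0 0 * z j = -z j := by
    rw [row_zero_eq_neg_mul_clearCoeff]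
    ring
  have hcols : ∑ l, star (U.1 l i.succ + U.1 l 0 * z i) * (U.1 l j.succ + U.1 l 0 * z j) =
      (1 : Matrix (Fin n) (Fin n) ℂ) i j + star (z i) * z j := by
    have hexpand (l : Fin (n + 1)) :
        star (U.1 l i.succ + U.1 l 0 * z i) * (U.1 l j.succ + U.1 l 0 * z j) =
          star (U.1 l i.succ) * U.1 l j.succ + star (U.1 l i.succ) * U.1 l 0 * z j +
            star (z i) * (star (U.1 l 0) * U.1 l j.succ) +
            star (z i) * z j * (star (U.1 l 0) * U.1 l 0) := by
      simp only [star_add, star_mul']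
      ring
    simp only [hexpand, Finset.sum_add_distrib, ← Finset.mul_sum, ← Finset.sum_mul,
      unitary_star_mul_apply]
    simp [Matrix.one_apply, (Fin.succ_ne_zero j).symm]
  rw [Fin.sum_univ_succ, hrow, hrow, star_neg] at hcols
  rw [Matrix.mul_apply]
  simp only [Matrix.star_apply, Matrix.of_apply]
  linear_combination hcols

/-- The Schur complement of the corner entry of `1 + U`, minus the identity. -/
noncomputable def schurReduce (U : Matrix.unitaryGroup (Fin (n + 1)) ℂ) :
    Matrix.unitaryGroup (Fin n) ℂ :=
  ⟨_, schurReduce_mem_unitaryGroup U⟩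

theorem det_one_add_eq_mul_det_schurReduce (U : Matrix.unitaryGroup (Fin (n + 1)) ℂ) :
    (1 + U.1).det = (1 + U.1 0 0) * (1 + (schurReduce U).1).det := by
  set B : Matrix (Fin (n + 1)) (Fin (n + 1)) ℂ := Matrix.of fun i j =>
    (1 + U.1) i j + Fin.cases 0 (clearCoeff U) j * (1 + U.1) i 0 with hB
  have hdet : B.det = (1 + U.1).det := by
    rw [← Matrix.det_transpose B, ← Matrix.det_transpose (1 + U.1)]
    exact Matrix.det_eq_of_forall_row_eq_smul_add_const (Fin.cases 0 (clearCoeff U)) 0 rfl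
      fun i j => rfl
  have hcorner : B 0 0 = 1 + U.1 0 0 := by simp [hB]
  have hclear (j : Fin n) : B 0 j.succ = 0 := by
    simp only [hB, Matrix.add_apply, Matrix.one_apply, Matrix.of_apply, (Fin.succ_ne_zero j).symm,
      ↓reduceIte, row_zero_eq_neg_mul_clearCoeff U j, zero_add, Fin.cases_succ]
    ring
  have hblock : B.submatrix Fin.succ Fin.succ = 1 + (schurReduce U).1 := by
    ext i j
    simp only [hB, Matrix.add_apply, Matrix.one_apply, Matrix.submatrix_apply, Matrix.of_apply,
      Fin.succ_inj, Fin.cases_succ, Fin.succ_ne_zero, ↓reduceIte, zero_add, schurReduce]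
    ring
  rw [← hdet, Matrix.det_succ_row_zero, Fin.sum_univ_succ]
  simp [hcorner, hclear, ← hblock]

theorem oneBlock_mem_unitaryGroup (h : Matrix.unitaryGroup (Fin n) ℂ) :
    (Matrix.of (Fin.cons (Pi.single 0 1) fun i => Fin.cons 0 (h.1 i)) :
      Matrix (Fin (n + 1)) (Fin (n + 1)) ℂ) ∈ Matrix.unitaryGroup (Fin (n + 1)) ℂ := by
  have hcol := unitary_star_mul_apply h
  rw [Matrix.mem_unitaryGroup_iff']
  ext i j
  rw [Matrix.mul_apply, Fin.sum_univ_succ]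
  cases i using Fin.cases <;> cases j using Fin.cases <;>
    simp_all [Matrix.star_apply, Matrix.one_apply, eq_comm]

/-- The block diagonal unitary matrix `diag(1, h)`. -/
noncomputable def oneBlock (h : Matrix.unitaryGroup (Fin n) ℂ) :
    Matrix.unitaryGroup (Fin (n + 1)) ℂ :=
  ⟨_, oneBlock_mem_unitaryGroup h⟩

theorem oneBlock_mul_apply_zero (h : Matrix.unitaryGroup (Fin n) ℂ)
    (U : Matrix.unitaryGroup (Fin (n + 1)) ℂ) (j : Fin (n + 1)) :
    (oneBlock h * U).1 0 j = U.1 0 j := by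
  rw [Matrix.UnitaryGroup.mul_val, Matrix.mul_apply, Fin.sum_univ_succ]
  simp [oneBlock]

theorem oneBlock_mul_apply_succ (h : Matrix.unitaryGroup (Fin n) ℂ)
    (U : Matrix.unitaryGroup (Fin (n + 1)) ℂ) (i : Fin n) (j : Fin (n + 1)) :
    (oneBlock h * U).1 i.succ j = ∑ k, h.1 i k * U.1 k.succ j := by
  rw [Matrix.UnitaryGroup.mul_val, Matrix.mul_apply, Fin.sum_univ_succ]
  simp [oneBlock]

theorem schurReduce_oneBlock_mul (h : Matrix.unitaryGroup (Fin n) ℂ)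
    (U : Matrix.unitaryGroup (Fin (n + 1)) ℂ) :
    schurReduce (oneBlock h * U) = h * schurReduce U := by
  have hcoeff (j : Fin n) : clearCoeff (oneBlock h * U) j = clearCoeff U j := by
    simp only [clearCoeff, oneBlock_mul_apply_zero]
  ext i j
  rw [Matrix.UnitaryGroup.mul_val, Matrix.mul_apply]
  simp only [schurReduce, Matrix.of_apply, oneBlock_mul_apply_succ, hcoeff, Finset.sum_mul,
    ← Finset.sum_add_distrib, mul_add, mul_assoc]

section DetMoments

variable [MeasurableSpace (Matrix.unitaryGroup (Fin n) ℂ)]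
  [BorelSpace (Matrix.unitaryGroup (Fin n) ℂ)]
  [MeasurableSpace (Matrix.unitaryGroup (Fin (n + 1)) ℂ)]
  [BorelSpace (Matrix.unitaryGroup (Fin (n + 1)) ℂ)]

theorem measurable_schurReduce :
    Measurable (schurReduce : Matrix.unitaryGroup (Fin (n + 1)) ℂ → _) := by
  have hentry (i j : Fin (n + 1)) :
      Measurable fun U : Matrix.unitaryGroup (Fin (n + 1)) ℂ => U.1 i j :=
    (continuous_unitaryGroup_apply i j).measurable
  have hemb : MeasurableEmbedding
      (fun (V : Matrix.unitaryGroup (Fin n) ℂ) (i j : Fin n) => V.1 i j) :=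
    (Continuous.isClosedEmbedding
      (continuous_pi fun i => continuous_pi fun j => continuous_unitaryGroup_apply i j)
      fun V W h => Subtype.ext h).measurableEmbedding
  rw [← hemb.measurable_comp_iff]
  exact measurable_pi_lambda _ fun i => measurable_pi_lambda _ fun j =>
    (hentry _ _).add ((hentry _ _).mul ((hentry _ _).div (measurable_const.add (hentry _ _))).neg)

theorem continuous_norm_det_one_add {m : ℕ} :
    Continuous fun U : Matrix.unitaryGroup (Fin m) ℂ => ‖(1 + U.1).det‖ :=
  (continuous_const.add continuous_subtype_val).matrix_det.norm

theorem integral_norm_det_one_add_pow_succ (σ : Measure (Matrix.unitaryGroup (Fin (n + 1)) ℂ))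
    [IsProbabilityMeasure σ] [σ.IsMulLeftInvariant] (k : ℕ) :
    ∫ U, ‖(1 + U.1).det‖ ^ k ∂σ =
      (∫ U, ‖1 + U.1 0 0‖ ^ k ∂σ) * ∫ V, ‖(1 + V.1).det‖ ^ k ∂(σ.map schurReduce) := by
  have hindep : ProbabilityTheory.IndepFun (fun U => U.1 0 0) schurReduce σ :=
    indepFun_of_equivariant measurable_schurReduce schurReduce_oneBlock_mul fun h U =>
      oneBlock_mul_apply_zero h U 0
  have hdet : Continuous fun V : Matrix.unitaryGroup (Fin n) ℂ => ‖(1 + V.1).det‖ ^ k :=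
    continuous_norm_det_one_add.pow k
  rw [integral_map measurable_schurReduce.aemeasurable hdet.aestronglyMeasurable,
    ← hindep.integral_fun_comp_mul_comp (f := fun z => ‖1 + z‖ ^ k)
      (continuous_unitaryGroup_apply 0 0).aemeasurable measurable_schurReduce.aemeasurable
      (by fun_prop) hdet.aestronglyMeasurable]
  simp only [det_one_add_eq_mul_det_schurReduce, norm_mul, mul_pow]

end DetMoments

theorem integral_norm_det_one_add_pow (n : ℕ)
    [mU : MeasurableSpace (Matrix.unitaryGroup (Fin n) ℂ)]
    [BorelSpace (Matrix.unitaryGroup (Fin n) ℂ)] (σ : Measure (Matrix.unitaryGroup (Fin n) ℂ))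
    [IsProbabilityMeasure σ] [σ.IsMulLeftInvariant] (k : ℕ) :
    ∫ U, ‖(1 + U.1).det‖ ^ (2 * k) ∂σ =
      ∏ j ∈ Finset.range n, ((2 * k + j)! : ℝ) * j ! / ((k + j)! : ℝ) ^ 2 := by
  induction n generalizing mU with
  | zero => simp
  | succ n ih =>
    let : MeasurableSpace (Matrix.unitaryGroup (Fin n) ℂ) := borel _
    have : BorelSpace (Matrix.unitaryGroup (Fin n) ℂ) := ⟨rfl⟩
    have := Measure.isProbabilityMeasure_map (μ := σ) measurable_schurReduce.aemeasurable
    have := isMulLeftInvariant_map_of_equivariant (μ := σ) measurable_schurReduce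
      schurReduce_oneBlock_mul
    rw [Finset.prod_range_succ, ← ih (σ.map schurReduce), integral_norm_det_one_add_pow_succ,
      integral_norm_one_add_entry_pow σ (Fintype.card_fin _), mul_comm]

end SchurReduction

section DetTraceBounds

open scoped ComplexOrder

theorem one_sub_sum_le_prod_one_sub {ι : Type*} (s : Finset ι) {x : ι → ℝ}
    (hx : ∀ i ∈ s, x i ∈ Set.Icc 0 1) : 1 - ∑ i ∈ s, x i ≤ ∏ i ∈ s, (1 - x i) := by
  classical
  induction s using Finset.induction_on with
  | empty => simp
  | insert a s ha ih =>
    rw [Finset.forall_mem_insert] at hx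
    rw [Finset.sum_insert ha, Finset.prod_insert ha]
    have hsum : 0 ≤ ∑ i ∈ s, x i := Finset.sum_nonneg fun i hi => (hx.2 i hi).1
    nlinarith [mul_le_mul_of_nonneg_left (ih hx.2) (sub_nonneg.2 hx.1.2), hx.1.1]

variable {𝕜 ι : Type*} [RCLike 𝕜] [Fintype ι] [DecidableEq ι] {B : Matrix ι ι 𝕜}

theorem eigenvalues_le_one (hB : B.IsHermitian) (hB1 : (1 - B).PosSemidef) (i : ι) :
    hB.eigenvalues i ≤ 1 := by
  set v := hB.eigenvectorBasis i
  have hform := hB1.re_dotProduct_nonneg v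
  have hunit : star (v : ι → 𝕜) ⬝ᵥ v = 1 := by
    rw [dotProduct_comm, ← EuclideanSpace.inner_eq_star_dotProduct, inner_self_eq_norm_sq_to_K,
      hB.eigenvectorBasis.orthonormal.1 i]
    simp
  rw [Matrix.sub_mulVec, Matrix.one_mulVec, hB.mulVec_eigenvectorBasis, dotProduct_sub,
    dotProduct_smul, hunit] at hform
  simpa [RCLike.smul_re] using hform

theorem det_one_sub_eq_prod_eigenvalues (hB : B.IsHermitian) :
    (1 - B).det = ((∏ i, (1 - hB.eigenvalues i) : ℝ) : 𝕜) := by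
  have h := Matrix.eval_charpoly B 1
  rw [map_one] at h
  rw [← h, hB.charpoly_eq, Polynomial.eval_prod]
  simp

theorem re_trace_eq_sum_eigenvalues (hB : B.IsHermitian) :
    RCLike.re B.trace = ∑ i, hB.eigenvalues i := by
  simp [hB.trace_eq_sum_eigenvalues]

theorem one_sub_re_trace_le_re_det_one_sub (hB : B.PosSemidef) (hB1 : (1 - B).PosSemidef) :
    1 - RCLike.re B.trace ≤ RCLike.re (1 - B).det := by
  rw [det_one_sub_eq_prod_eigenvalues hB.isHermitian, RCLike.ofReal_re,
    re_trace_eq_sum_eigenvalues hB.isHermitian]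
  exact one_sub_sum_le_prod_one_sub _ fun i _ =>
    ⟨hB.eigenvalues_nonneg i, eigenvalues_le_one hB.isHermitian hB1 i⟩

theorem re_det_one_sub_le_exp_neg_re_trace (hB : B.IsHermitian) (hB1 : (1 - B).PosSemidef) :
    RCLike.re (1 - B).det ≤ Real.exp (-RCLike.re B.trace) := by
  rw [det_one_sub_eq_prod_eigenvalues hB, RCLike.ofReal_re, re_trace_eq_sum_eigenvalues hB,
    ← Finset.sum_neg_distrib, Real.exp_sum]
  exact Finset.prod_le_prod (fun i _ => sub_nonneg.2 (eigenvalues_le_one hB hB1 i))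
    fun i _ => Real.one_sub_le_exp_neg _

end DetTraceBounds

section Comparison

open scoped ComplexOrder

theorem star_one_add_mul_one_add_of_mem_unitary {R : Type*} [Ring R] [StarRing R] {u : R}
    (hu : u ∈ unitary R) : star (1 + u) * (1 + u) = 4 - star (1 - u) * (1 - u) := by
  have h4 : (4 : R) = 1 + 1 + 2 • (star u * u) := by
    rw [Unitary.star_mul_self_of_mem hu]
    norm_num
  rw [h4, star_add, star_sub, star_one]
  noncomm_ring

variable {N : ℕ}

/-- The Gram matrix of `M / 2`. For unitary `U`, those of `1 + U` and `1 - U` add up to `1`. -/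
noncomputable def quarterGram (M : Matrix (Fin N) (Fin N) ℂ) : Matrix (Fin N) (Fin N) ℂ :=
  (4⁻¹ : ℝ) • (M.conjTranspose * M)

theorem posSemidef_quarterGram (M : Matrix (Fin N) (Fin N) ℂ) : (quarterGram M).PosSemidef :=
  (Matrix.posSemidef_conjTranspose_mul_self M).smul (by norm_num)

theorem one_sub_quarterGram_one_sub (U : Matrix.unitaryGroup (Fin N) ℂ) :
    1 - quarterGram (1 - U.1) = quarterGram (1 + U.1) := by
  have h4 : (4⁻¹ : ℝ) • (4 : Matrix (Fin N) (Fin N) ℂ) = 1 := by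
    ext i j
    simp [Matrix.ofNat_apply, Matrix.one_apply]
  rw [quarterGram, quarterGram, ← Matrix.star_eq_conjTranspose, ← Matrix.star_eq_conjTranspose,
    star_one_add_mul_one_add_of_mem_unitary U.2, smul_sub, h4]

theorem re_trace_quarterGram (M : Matrix (Fin N) (Fin N) ℂ) :
    (quarterGram M).trace.re = hsNorm M ^ 2 / 4 := by
  have htrace : (M.conjTranspose * M).trace.re = hsNorm M ^ 2 := by
    rw [hsNorm, Real.sq_sqrt (by positivity), Finset.sum_comm]
    simp [Matrix.trace, Matrix.mul_apply, Complex.sq_norm, Complex.normSq_apply]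
  rw [quarterGram, Matrix.trace_smul, Complex.smul_re, htrace, smul_eq_mul, inv_mul_eq_div]

theorem re_det_quarterGram (M : Matrix (Fin N) (Fin N) ℂ) :
    (quarterGram M).det.re = ‖M.det‖ ^ 2 / 4 ^ N := by
  have hdet : star M.det * M.det = ((‖M.det‖ ^ 2 : ℝ) : ℂ) :=
    (Complex.conj_mul' _).trans (by norm_cast)
  rw [quarterGram, ← algebraMap_smul ℂ, Matrix.det_smul, Matrix.det_mul, Matrix.det_conjTranspose,
    hdet, Fintype.card_fin, Complex.coe_algebraMap, ← Complex.ofReal_pow, Complex.re_ofReal_mul,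
    Complex.ofReal_re, inv_pow, inv_mul_eq_div]

/-- The squared modulus of `det ((1 + U) / 2)`, which near the identity plays the role of
`1 - ‖1 - U‖² / 4`. -/
noncomputable def normSqDetHalf (U : Matrix.unitaryGroup (Fin N) ℂ) : ℝ :=
  ‖(1 + U.1).det‖ ^ 2 / 4 ^ N

theorem normSqDetHalf_eq_re_det (U : Matrix.unitaryGroup (Fin N) ℂ) :
    normSqDetHalf U = (1 - quarterGram (1 - U.1)).det.re := by
  rw [one_sub_quarterGram_one_sub, re_det_quarterGram, normSqDetHalf]

theorem posSemidef_one_sub_quarterGram_one_sub (U : Matrix.unitaryGroup (Fin N) ℂ) :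
    (1 - quarterGram (1 - U.1)).PosSemidef :=
  one_sub_quarterGram_one_sub U ▸ posSemidef_quarterGram _

theorem one_sub_hsNorm_sq_div_four_le_normSqDetHalf (U : Matrix.unitaryGroup (Fin N) ℂ) :
    1 - hsNorm (1 - U.1) ^ 2 / 4 ≤ normSqDetHalf U := by
  rw [← re_trace_quarterGram, normSqDetHalf_eq_re_det]
  exact one_sub_re_trace_le_re_det_one_sub (posSemidef_quarterGram _)
    (posSemidef_one_sub_quarterGram_one_sub U)

theorem normSqDetHalf_le_exp_neg_hsNorm_sq_div_four (U : Matrix.unitaryGroup (Fin N) ℂ) :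
    normSqDetHalf U ≤ Real.exp (-(hsNorm (1 - U.1) ^ 2 / 4)) := by
  rw [← re_trace_quarterGram, normSqDetHalf_eq_re_det]
  exact re_det_one_sub_le_exp_neg_re_trace (posSemidef_quarterGram _).isHermitian
    (posSemidef_one_sub_quarterGram_one_sub U)

theorem normSqDetHalf_mem_Icc (U : Matrix.unitaryGroup (Fin N) ℂ) :
    normSqDetHalf U ∈ Set.Icc (0 : ℝ) 1 :=
  ⟨by unfold normSqDetHalf; positivity, (normSqDetHalf_le_exp_neg_hsNorm_sq_div_four U).trans
    (Real.exp_le_one_iff.2 (neg_nonpos.2 (by positivity)))⟩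

end Comparison

section MomentAsymptotics

theorem mul_factorial_ratio_sq_eq_div_wallis (k : ℕ) :
    k * (((2 * k)! : ℝ) / ((k ! : ℝ) ^ 2 * 4 ^ k)) ^ 2 = k / (2 * k + 1) / Real.Wallis.W k := by
  have h4 : (4 : ℝ) ^ k = 2 ^ (2 * k) := by rw [pow_mul]; norm_num
  rw [Real.Wallis.W_eq_factorial_ratio, h4]
  field_simp
  ring

theorem tendsto_sqrt_mul_factorial_ratio :
    Tendsto (fun k : ℕ => √k * (((2 * k)! : ℝ) / ((k ! : ℝ) ^ 2 * 4 ^ k))) atTop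
      (𝓝 (√Real.pi)⁻¹) := by
  have hwallis := Stirling.tendsto_self_div_two_mul_self_add_one.div
    Real.Wallis.tendsto_W_nhds_pi_div_two (by positivity)
  have hlim : √(1 / 2 / (Real.pi / 2)) = (√Real.pi)⁻¹ := by
    rw [← Real.sqrt_inv]
    congr 1
    field_simp
  refine hlim ▸ hwallis.sqrt.congr fun k => ?_
  rw [Pi.div_apply, ← mul_factorial_ratio_sq_eq_div_wallis, Real.sqrt_mul k.cast_nonneg,
    Real.sqrt_sq (by positivity)]

theorem tendsto_mul_two_mul_add_div_add_sq (a : ℝ) :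
    Tendsto (fun k : ℕ => (k : ℝ) * ((2 * k + a) / (k + a) ^ 2)) atTop (𝓝 2) := by
  have hdiv : Tendsto (fun k : ℕ => a / (k : ℝ)) atTop (𝓝 0) :=
    tendsto_const_div_atTop_nhds_zero_nat a
  have hlim : Tendsto (fun k : ℕ => (2 + a / (k : ℝ)) / (1 + a / k) ^ 2) atTop
      (𝓝 ((2 + 0) / (1 + 0) ^ 2)) :=
    (hdiv.const_add 2).div ((hdiv.const_add 1).pow 2) (by norm_num)
  rw [add_zero, add_zero, one_pow, div_one] at hlim
  refine hlim.congr' ?_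
  filter_upwards [eventually_gt_atTop 0] with k hk
  field_simp

theorem tendsto_rpow_mul_factorial_ratio (j : ℕ) :
    Tendsto (fun k : ℕ => (k : ℝ) ^ ((j : ℝ) + 1 / 2) *
      (((2 * k + j)! : ℝ) * j ! / ((k + j)! : ℝ) ^ 2 / 4 ^ k)) atTop
      (𝓝 ((j ! : ℝ) * 2 ^ j / √Real.pi)) := by
  induction j with
  | zero =>
    simpa [Real.sqrt_eq_rpow, div_div] using tendsto_sqrt_mul_factorial_ratio
  | succ j ih =>
    have hstep := ih.mul ((tendsto_mul_two_mul_add_div_add_sq (j + 1)).const_mul ((j : ℝ) + 1))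
    have hlim : (j ! : ℝ) * 2 ^ j / √Real.pi * (((j : ℝ) + 1) * 2) =
        ((j + 1)! : ℝ) * 2 ^ (j + 1) / √Real.pi := by
      rw [Nat.factorial_succ]
      push_cast
      ring
    refine hlim ▸ hstep.congr' ?_
    filter_upwards [eventually_gt_atTop 0] with k hk
    have hexp : ((j + 1 : ℕ) : ℝ) + 1 / 2 = ((j : ℝ) + 1 / 2) + 1 := by push_cast; ring
    have hfact (m : ℕ) : (m + (j + 1))! = (m + j + 1) * (m + j)! := Nat.factorial_succ (m + j)
    rw [hexp, Real.rpow_add_one (by positivity), hfact, hfact, Nat.factorial_succ j]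
    push_cast
    field_simp
    ring

theorem tendsto_rpow_mul_prod_factorial_ratio (N : ℕ) :
    Tendsto (fun k : ℕ => (k : ℝ) ^ ((N : ℝ) ^ 2 / 2) *
      ∏ j ∈ Finset.range N, (((2 * k + j)! : ℝ) * j ! / ((k + j)! : ℝ) ^ 2 / 4 ^ k)) atTop
      (𝓝 (∏ j ∈ Finset.range N, ((j ! : ℝ) * 2 ^ j / √Real.pi))) := by
  induction N with
  | zero => simp
  | succ N ih =>
    rw [Finset.prod_range_succ]
    refine (ih.mul (tendsto_rpow_mul_factorial_ratio N)).congr' ?_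
    filter_upwards [eventually_gt_atTop 0] with k hk
    have hexp : ((N + 1 : ℕ) : ℝ) ^ 2 / 2 = (N : ℝ) ^ 2 / 2 + ((N : ℝ) + 1 / 2) := by
      push_cast
      ring
    rw [Finset.prod_range_succ, hexp, Real.rpow_add (by positivity) _ ((N : ℝ) + 1 / 2),
      mul_mul_mul_comm]

end MomentAsymptotics

section Constants

theorem prod_range_two_pow (N : ℕ) :
    ∏ j ∈ Finset.range N, (2 : ℝ) ^ j = 2 ^ (((N : ℝ) ^ 2 - N) / 2) := by
  induction N with
  | zero => simp
  | succ N ih =>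
    rw [Finset.prod_range_succ, ih, ← Real.rpow_natCast 2 N, ← Real.rpow_add two_pos]
    congr 1
    push_cast
    ring

theorem prod_range_factorial_eq_prod_Icc (N : ℕ) :
    ∏ j ∈ Finset.range N, (j ! : ℝ) = ∏ j ∈ Finset.Icc 1 (N - 1), (j ! : ℝ) := by
  refine (Finset.prod_subset (fun j hj => ?_) fun j hj hj' => ?_).symm
  · rw [Finset.mem_Icc] at hj
    exact Finset.mem_range.2 (by omega)
  · rw [Finset.mem_range] at hj
    rw [Finset.mem_Icc] at hj'
    simp [show j = 0 by omega]

theorem prod_range_factorial_mul_two_pow_div_sqrt_pi (N : ℕ) :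
    (∏ j ∈ Finset.range N, ((j ! : ℝ) * 2 ^ j / √Real.pi)) / 2 ^ (N ^ 2) =
      (∏ j ∈ Finset.Icc 1 (N - 1), (j ! : ℝ)) /
        ((2 * Real.pi) ^ ((N : ℝ) / 2) * (2 : ℝ) ^ ((N : ℝ) ^ 2 / 2)) := by
  have hpi : √Real.pi ^ N = Real.pi ^ ((N : ℝ) / 2) := by
    rw [Real.sqrt_eq_rpow, ← Real.rpow_mul_natCast Real.pi_pos.le]
    ring_nf
  have htwo : (2 : ℝ) ^ (N ^ 2) =
      2 ^ (((N : ℝ) ^ 2 - N) / 2) * (2 ^ ((N : ℝ) / 2) * 2 ^ ((N : ℝ) ^ 2 / 2)) := by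
    rw [← Real.rpow_add two_pos, ← Real.rpow_add two_pos, ← Real.rpow_natCast]
    congr 1
    push_cast
    ring
  rw [Finset.prod_div_distrib, Finset.prod_mul_distrib, Finset.prod_const, Finset.card_range,
    prod_range_two_pow, prod_range_factorial_eq_prod_Icc, hpi, htwo,
    Real.mul_rpow zero_le_two Real.pi_pos.le]
  field_simp

theorem sq_div_four_rpow {δ : ℝ} (hδ : 0 ≤ δ) (N : ℕ) :
    (δ ^ 2 / 4) ^ ((N : ℝ) ^ 2 / 2) = δ ^ (N ^ 2) / 2 ^ (N ^ 2) := by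
  have hsq : δ ^ 2 / 4 = (δ / 2) ^ 2 := by ring
  rw [hsq, ← Real.rpow_natCast_mul (by positivity), ← div_pow, ← Real.rpow_natCast (δ / 2) (N ^ 2)]
  congr 1
  push_cast
  ring

end Constants

section SmallBall

theorem tendsto_nhdsGT_zero_of_hasDerivAt_one {u : ℝ → ℝ} (hu0 : u 0 = 0)
    (hu : HasDerivAt u 1 0) : Tendsto u (𝓝[>] 0) (𝓝[>] 0) ∧
      Tendsto (fun x => u x / x) (𝓝[>] 0) (𝓝 1) := by
  have hslope : Tendsto (fun x => u x / x) (𝓝[>] 0) (𝓝 1) := by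
    simpa [hu0, div_eq_inv_mul] using hu.tendsto_slope_zero_right
  refine ⟨tendsto_nhdsWithin_iff.2 ⟨?_, ?_⟩, hslope⟩
  · simpa [hu0] using hu.continuousAt.tendsto.mono_left nhdsWithin_le_nhds
  · filter_upwards [hslope.eventually_const_lt one_pos, self_mem_nhdsWithin] with x hx hx0
    exact (div_pos_iff_of_pos_right hx0).1 hx

theorem tendsto_comp_div_rpow_of_hasDerivAt_one {F u : ℝ → ℝ} {α L : ℝ}
    (hF : Tendsto (fun x => F x / x ^ α) (𝓝[>] 0) (𝓝 L)) (hu0 : u 0 = 0)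
    (hu : HasDerivAt u 1 0) : Tendsto (fun x => F (u x) / x ^ α) (𝓝[>] 0) (𝓝 L) := by
  obtain ⟨hlim, hslope⟩ := tendsto_nhdsGT_zero_of_hasDerivAt_one hu0 hu
  have hmul := (hF.comp hlim).mul (hslope.rpow_const (p := α) (Or.inl one_ne_zero))
  rw [Real.one_rpow, mul_one] at hmul
  refine hmul.congr' ?_
  filter_upwards [hlim self_mem_nhdsWithin, self_mem_nhdsWithin] with x (hux : 0 < u x) hx
  rw [Function.comp_apply, Real.div_rpow hux.le hx.le,
    div_mul_div_cancel₀ (Real.rpow_pos_of_pos hux α).ne']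

theorem tendsto_sq_div_four_nhdsGT_zero :
    Tendsto (fun δ : ℝ => δ ^ 2 / 4) (𝓝[>] 0) (𝓝[>] 0) := by
  refine tendsto_nhdsWithin_iff.2 ⟨?_, ?_⟩
  · have hcont : Continuous fun δ : ℝ => δ ^ 2 / 4 := by fun_prop
    simpa using (hcont.tendsto 0).mono_left nhdsWithin_le_nhds
  · filter_upwards [self_mem_nhdsWithin] with δ (hδ : 0 < δ)
    exact Set.mem_Ioi.2 (by positivity)

theorem tendsto_measureReal_div_rpow_of_comparison {Ω : Type*} [MeasurableSpace Ω] {μ : Measure Ω}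
    [IsFiniteMeasure μ] {X D : Ω → ℝ} (hlower : ∀ ω, 1 - D ω ≤ X ω)
    (hupper : ∀ ω, X ω ≤ Real.exp (-D ω)) {α L : ℝ}
    (hX : Tendsto (fun r => μ.real {ω | Real.exp (-r) ≤ X ω} / r ^ α) (𝓝[>] 0) (𝓝 L)) :
    Tendsto (fun r => μ.real {ω | D ω ≤ r} / r ^ α) (𝓝[>] 0) (𝓝 L) := by
  have hlog : HasDerivAt (fun r : ℝ => -Real.log (1 - r)) 1 0 := by
    simpa using (((hasDerivAt_id (0 : ℝ)).const_sub 1).log (by simp)).fun_neg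
  refine tendsto_of_tendsto_of_tendsto_of_le_of_le' hX
    (tendsto_comp_div_rpow_of_hasDerivAt_one hX (by simp) hlog) ?_ ?_
  · filter_upwards [self_mem_nhdsWithin] with r (hr : 0 < r)
    refine div_le_div_of_nonneg_right (measureReal_mono fun ω hω => ?_) (by positivity)
    exact neg_le_neg_iff.1 (Real.exp_le_exp.1 (le_trans hω (hupper ω)))
  · filter_upwards [Ioo_mem_nhdsGT (zero_lt_one' ℝ)] with r ⟨hr0, hr1⟩
    refine div_le_div_of_nonneg_right (measureReal_mono fun ω hω => ?_) (by positivity)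
    simp only [Set.mem_ofPred_eq, neg_neg, Real.exp_log (sub_pos.2 hr1)] at hω ⊢
    linarith [hlower ω]

variable {N : ℕ} [MeasurableSpace (Matrix.unitaryGroup (Fin N) ℂ)]
  [BorelSpace (Matrix.unitaryGroup (Fin N) ℂ)] (σ : Measure (Matrix.unitaryGroup (Fin N) ℂ))
  [IsProbabilityMeasure σ] [σ.IsMulLeftInvariant]

theorem integral_normSqDetHalf_pow (k : ℕ) :
    ∫ U, normSqDetHalf U ^ k ∂σ =
      ∏ j ∈ Finset.range N, (((2 * k + j)! : ℝ) * j ! / ((k + j)! : ℝ) ^ 2 / 4 ^ k) := by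
  simp only [normSqDetHalf, div_pow, ← pow_mul, mul_comm N k]
  rw [Finset.prod_div_distrib, ← integral_norm_det_one_add_pow N σ k, Finset.prod_const,
    Finset.card_range, integral_div, ← pow_mul]

theorem tendsto_measureReal_hsNorm_sq_div_four_le (hN : 1 ≤ N) :
    Tendsto (fun r => σ.real {U | hsNorm (1 - U.1) ^ 2 / 4 ≤ r} / r ^ ((N : ℝ) ^ 2 / 2)) (𝓝[>] 0)
      (𝓝 ((∏ j ∈ Finset.range N, ((j ! : ℝ) * 2 ^ j / √Real.pi)) /
        Real.Gamma ((N : ℝ) ^ 2 / 2 + 1))) := by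
  have hcont : Continuous (normSqDetHalf (N := N)) :=
    (continuous_norm_det_one_add.pow 2).div_const _
  have hmoments := tendsto_rpow_mul_prod_factorial_ratio N
  simp only [← integral_normSqDetHalf_pow σ] at hmoments
  exact tendsto_measureReal_div_rpow_of_comparison one_sub_hsNorm_sq_div_four_le_normSqDetHalf
    normSqDetHalf_le_exp_neg_hsNorm_sq_div_four <|
    tendsto_measureReal_exp_neg_le_div_rpow (by positivity) hcont.measurable
      normSqDetHalf_mem_Icc hmoments

end SmallBall

/-- Here `σ` is the Haar probability measure on the unitary group `U(N)`, on the Borel σ-algebra of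
the topology inherited from the space of complex matrices, and the ball is
taken in the Hilbert–Schmidt norm. -/
theorem theorem6p1 (N : ℕ) (hN : 1 ≤ N)
    [MeasurableSpace (Matrix.unitaryGroup (Fin N) ℂ)] [BorelSpace (Matrix.unitaryGroup (Fin N) ℂ)]
    (σ : Measure (Matrix.unitaryGroup (Fin N) ℂ)) [σ.IsHaarMeasure] [IsProbabilityMeasure σ] :
    Tendsto
      (fun δ : ℝ =>
        σ.real {U : Matrix.unitaryGroup (Fin N) ℂ |
          hsNorm ((1 : Matrix (Fin N) (Fin N) ℂ) - (U : Matrix (Fin N) (Fin N) ℂ)) ≤ δ} / δ ^ (N ^ 2))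
      (𝓝[>] 0)
      (𝓝 ((∏ j ∈ Finset.Icc 1 (N - 1), (j ! : ℝ)) /
        ((2 * Real.pi) ^ ((N : ℝ) / 2) * (2 : ℝ) ^ ((N : ℝ) ^ 2 / 2) *
          Real.Gamma ((N : ℝ) ^ 2 / 2 + 1)))) := by
  rw [← div_div, ← prod_range_factorial_mul_two_pow_div_sqrt_pi, div_right_comm]
  refine (((tendsto_measureReal_hsNorm_sq_div_four_le σ hN).comp
    tendsto_sq_div_four_nhdsGT_zero).div_const (2 ^ (N ^ 2))).congr' ?_
  filter_upwards [self_mem_nhdsWithin] with δ (hδ : 0 < δ)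
  have hball (U : Matrix.unitaryGroup (Fin N) ℂ) :
      hsNorm (1 - U.1) ^ 2 / 4 ≤ δ ^ 2 / 4 ↔ hsNorm (1 - U.1) ≤ δ := by
    rw [div_le_div_iff_of_pos_right four_pos]
    exact pow_le_pow_iff_left₀ (Real.sqrt_nonneg _) hδ.le two_ne_zero
  simp only [Function.comp_apply, hball, sq_div_four_rpow hδ.le]
  field_simp
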